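/- Let $T$ be an infinite, locally finite tree that is leafless, i.e. has no vertex of valency $1$. Write $VT$ for its vertex set, $ET$ for its set of oriented edges and, for $v \in VT$, $E(v)$ for the set of oriented edges with origin $v$. Give $\mathrm{Aut}(T)$ the topology of pointwise convergence for its action on the discrete set $VT \sqcup ET$. Let $G$ be a topological group acting continuously on $T$ by automorphisms, i.e. through a continuous homomorphism $G \to \mathrm{Aut}(T)$, with finitely many orbits of vertices. For $v \in VT$, let $F(v) \leq \mathrm{Sym}(E(v))$ be the local action of $G$ at $v$, i.e. the permutation group induced on $E(v)$ by the stabilizer of $v$ in $G$. Suppose that for every $v \in VT$ the subgroup of $F(v)$ generated by the stabilizers $F(v)_e$, $e \in E(v)$, is not transitive on $E(v)$. Then $G$ is virtually indicable: there are an open subgroup $U \leq G$ of finite index and a continuous surjective homomorphism $U \to \mathbf{Z}$, where $\mathbf{Z}$ is discrete. -/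

import Mathlib

namespace TreeAction

variable {V : Type*} {T : SimpleGraph V}

/-- The automorphism `a` acting on oriented edges: `(u, w)` is sent to `(a u, a w)`. -/
def mapEdge (a : T ≃g T) (e : T.Dart) : T.Dart :=
  ⟨(a e.fst, a e.snd), a.map_rel_iff.2 e.adj⟩

/-- The topology of pointwise convergence on the automorphism group, for its action on the
vertices and on the oriented edges, both viewed as discrete sets. -/
instance autTopology : TopologicalSpace (T ≃g T) :=
  TopologicalSpace.induced (fun a : T ≃g T => (fun v : V => a v))
      (@Pi.topologicalSpace V (fun _ => V) (fun _ => ⊥)) ⊓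
    TopologicalSpace.induced (fun a : T ≃g T => (fun e : T.Dart => mapEdge a e))
      (@Pi.topologicalSpace T.Dart (fun _ => T.Dart) (fun _ => ⊥))

/-- The set `E(v)` of oriented edges with origin `v`. -/
def EdgesAt (T : SimpleGraph V) (v : V) : Type _ := {e : T.Dart // e.fst = v}

variable {G : Type*} [Group G]

/-- The stabilizer in `G` of the vertex `v`. -/
def vertexStabilizer (φ : G →* (T ≃g T)) (v : V) : Subgroup G where
  carrier := {g | φ g v = v}
  one_mem' := by simp
  mul_mem' := by
    intro a b ha hb
    simp only [Set.mem_ofPred_eq, map_mul, RelIso.mul_apply] at *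
    rw [hb, ha]
  inv_mem' := by
    intro a ha
    simp only [Set.mem_ofPred_eq, map_inv] at *
    conv_lhs => rw [← ha]
    exact RelIso.inv_apply_self _ _

/-- The action of the stabilizer of `v` on the set of edges with origin `v`. -/
def edgeAction (φ : G →* (T ≃g T)) (v : V) :
    vertexStabilizer φ v →* Equiv.Perm (EdgesAt T v) :=
  letI : MulAction (vertexStabilizer φ v) (EdgesAt T v) :=
    { smul := fun g e => ⟨mapEdge (φ g) e.1, (congrArg (φ (g : G)) e.2).trans g.2⟩
      one_smul := by
        rintro ⟨⟨⟨x, y⟩, h⟩, rfl⟩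
        apply Subtype.ext
        apply SimpleGraph.Dart.ext
        change (φ (1 : G) x, φ (1 : G) y) = (x, y)
        simp
      mul_smul := by
        rintro g h ⟨⟨⟨x, y⟩, hxy⟩, hx⟩
        apply Subtype.ext
        apply SimpleGraph.Dart.ext
        change (φ ((g : G) * h) x, φ ((g : G) * h) y) = (φ g (φ h x), φ g (φ h y))
        simp }
  MulAction.toPermHom _ _

/-- The local action `F(v) ≤ Sym(E(v))`. -/
def localAction (φ : G →* (T ≃g T)) (v : V) : Subgroup (Equiv.Perm (EdgesAt T v)) :=
  (edgeAction φ v).range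

/-- For a permutation group `F ≤ Sym(Ω)`, the subgroup generated by its point stabilizers. -/
def pointStabilizerSubgroup {Ω : Type*} (F : Subgroup (Equiv.Perm Ω)) :
    Subgroup (Equiv.Perm Ω) :=
  Subgroup.closure {σ | σ ∈ F ∧ ∃ x, σ x = x}

/-- The orbit of the vertex `v` under `G`. -/
def vertexOrbit (φ : G →* (T ≃g T)) (v : V) : Set V := Set.range fun g => φ g v

/-- Some open subgroup of finite index has a continuous surjective homomorphism onto `ℤ`. -/
def VirtuallyIndicable (G : Type*) [Group G] [TopologicalSpace G] : Prop :=
  ∃ U : Subgroup G, IsOpen (U : Set G) ∧ U.FiniteIndex ∧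
    ∃ f : U →* Multiplicative ℤ, Continuous f ∧ Function.Surjective f

end TreeAction

/-! For a vertex v let N(v) be the subgroup generated by the stabilizers of the edges at v
(`edgeStabilizers`). It is normal of finite index in G_v and, by hypothesis, not transitive on E(v).
The crux is a finite-index subgroup U acting without inversions and with U ∩ G_v ≤ N(v) for all v.
Then U\T is a finite graph without vertices of valency one, so it contains a simple closed path;
counting signed crossings of one edge of that path maps U onto ℤ and kills vertex stabilizers
(`exists_surjective_int`).

To find U, the quotients G_v/N(v) are encoded in a G-invariant cocycle δ with values in a finite
group (`exists_invariant_cocycle`). On a tree δ integrates to edge labellings, each determined by a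
single value, so there are finitely many; U is the kernel of the G-action on them
(`exists_finiteIndex_subgroup`). An extra ℤ/2 coordinate that changes on reversal excludes
inversions. -/

namespace TreeAction

open MulAction SimpleGraph

/-! ### Local systems on trees -/

section Tree

variable {V : Type*} {T : SimpleGraph V}

/-- Parallel transport of `x` along a walk. -/
def transport {X : Type*} (t : T.Dart → X → X) {u v : V} (p : T.Walk u v) (x : X) : X :=
  p.darts.foldl (fun y d => t d y) x

/-- A local system on a tree has a global section. -/
theorem exists_section_of_isTree (hT : T.IsTree) {X : Type*} (t : T.Dart → X → X)
    (ht : ∀ d x, t d.symm (t d x) = x) (x : X) :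
    ∃ s : V → X, ∀ d : T.Dart, s d.snd = t d (s d.fst) := by
  classical
  obtain ⟨v₀⟩ := hT.connected.nonempty
  choose p hp _ using fun w => hT.existsUnique_path v₀ w
  refine ⟨fun w => transport t (p w) x, ?_⟩
  have key : ∀ d : T.Dart, d.fst ∈ (p d.snd).support →
      transport t (p d.snd) x = t d (transport t (p d.fst) x) := by
    intro d hd
    rw [hT.isAcyclic.path_concat (hp d.fst) (hp d.snd) d.adj hd]
    simp [transport, Walk.darts_concat]
  intro d
  by_cases hd : d.fst ∈ (p d.snd).support
  · exact key d hd
  · have hd' : d.symm.fst ∈ (p d.symm.snd).support :=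
      hT.isAcyclic.mem_support_of_ne_mem_support_of_adj_of_isPath (hp d.fst) (hp d.snd)
        d.adj hd
    have h := key d.symm hd'
    have h' := congrArg (t d) h
    have h2 := ht d.symm (transport t (p d.snd) x)
    rw [Dart.symm_symm] at h2
    exact (h'.trans h2).symm

theorem eq_of_forall_dart (hT : T.Connected) {Y : Type*} {f : V → Y}
    (hf : ∀ d : T.Dart, f d.snd = f d.fst) (v w : V) : f v = f w := by
  obtain ⟨p⟩ := hT.preconnected v w
  induction p with
  | nil => rfl
  | cons h _ ih => exact (hf ⟨(_, _), h⟩).symm.trans ih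

end Tree

/-! ### The invariant cocycle of the local quotients -/

section Cocycle

universe u v w

variable {G : Type u} {V : Type v} {D : Type w} [Group G] [MulAction G V] [MulAction G D]
  {src : D → V}

/-- The subgroup generated by the stabilizers of the edges with origin `v`. -/
def edgeStabilizers (G : Type*) [Group G] [MulAction G D] (src : D → V) (v : V) : Subgroup G :=
  Subgroup.closure {g | ∃ d, src d = v ∧ g • d = d}

theorem conj_mem_edgeStabilizers (hsrc : ∀ (g : G) d, src (g • d) = g • src d) {v : V} {g : G}
    (hg : g ∈ edgeStabilizers G src v) (h : G) :
    h * g * h⁻¹ ∈ edgeStabilizers G src (h • v) := by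
  have : edgeStabilizers G src v ≤
      (edgeStabilizers G src (h • v)).comap (MulAut.conj h).toMonoidHom := by
    refine (Subgroup.closure_le _).2 ?_
    rintro k ⟨d, hd, hk⟩
    refine Subgroup.subset_closure ⟨h • d, by rw [hsrc, hd], ?_⟩
    simp [mul_smul, hk]
  exact this hg

theorem normal_edgeStabilizers (hsrc : ∀ (g : G) d, src (g • d) = g • src d) (v : V) :
    ((edgeStabilizers G src v).subgroupOf (stabilizer G v)).Normal := by
  refine ⟨fun g hg h => ?_⟩
  have := conj_mem_edgeStabilizers hsrc (Subgroup.mem_subgroupOf.1 hg) (h : G)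
  rw [show (h : G) • v = v from h.2] at this
  exact Subgroup.mem_subgroupOf.2 this

/-- The subgroup contains the stabilizer of `d`, so the images of `d`, finitely many, separate its
cosets. -/
theorem finite_quotient_edgeStabilizers (hsrc : ∀ (g : G) d, src (g • d) = g • src d)
    {v : V} (hfin : Finite {d // src d = v}) (hne : ∃ d, src d = v) :
    Finite (stabilizer G v ⧸ (edgeStabilizers G src v).subgroupOf (stabilizer G v)) := by
  obtain ⟨d, hd⟩ := hne
  refine Finite.of_injective
    (fun q => (⟨(q.out : G) • d, by rw [hsrc, hd]; exact q.out.2⟩ : {d // src d = v})) ?_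
  intro q q' h
  have h' : (q.out : G) • d = (q'.out : G) • d := congrArg Subtype.val h
  rw [← q.out_eq, ← q'.out_eq]
  refine QuotientGroup.eq.2 (Subgroup.mem_subgroupOf.2 (Subgroup.subset_closure ⟨d, hd, ?_⟩))
  simp [mul_smul, ← h']

/-- The finite local quotients of the representatives of the vertex orbits embed in one finite
group. -/
theorem exists_finite_local_quotient (hsrc : ∀ (g : G) d, src (g • d) = g • src d)
    [Finite (orbitRel.Quotient G V)] (hfin : ∀ v, Finite {d // src d = v})
    (hne : ∀ v, ∃ d, src d = v) :
    ∃ (K : Type (max u v)) (_ : Group K) (_ : Finite K) (ρ : orbitRel.Quotient G V → G → K),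
      (∀ i g h, g ∈ stabilizer G i.out → h ∈ stabilizer G i.out → ρ i (g * h) = ρ i g * ρ i h) ∧
      ∀ i g, g ∈ stabilizer G i.out → (ρ i g = 1 ↔ g ∈ edgeStabilizers G src i.out) := by
  classical
  have := normal_edgeStabilizers hsrc
  have := fun v => finite_quotient_edgeStabilizers hsrc (hfin v) (hne v)
  refine ⟨∀ i : orbitRel.Quotient G V, stabilizer G i.out ⧸
    (edgeStabilizers G src i.out).subgroupOf (stabilizer G i.out), inferInstance, inferInstance,
    fun i g => if h : g ∈ stabilizer G i.out then
      Pi.mulSingle i (QuotientGroup.mk ⟨g, h⟩) else 1, ?_, ?_⟩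
  · intro i g h hg hh
    dsimp only
    rw [dif_pos hg, dif_pos hh, dif_pos (mul_mem hg hh), ← Pi.mulSingle_mul]
    rfl
  · intro i g hg
    dsimp only
    rw [dif_pos hg, Pi.mulSingle_eq_one_iff, QuotientGroup.eq_one_iff, Subgroup.mem_subgroupOf]

/-- A choice of elements moving the orbit representatives to the origins of edges, such that
pulling an edge back only depends on its orbit. -/
theorem exists_translation (hsrc : ∀ (g : G) d, src (g • d) = g • src d) :
    ∃ h : D → G,
      (∀ d, h d • (Quotient.mk _ (src d) : orbitRel.Quotient G V).out = src d) ∧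
      ∀ (g : G) d, (h (g • d))⁻¹ • g • d = (h d)⁻¹ • d := by
  have hx : ∀ d : D, ∃ x : G, x • (Quotient.mk _ d : orbitRel.Quotient G D).out = d := fun d =>
    (orbitRel G D).symm (Quotient.mk_out (s := orbitRel G D) d)
  have hy : ∀ v : V, ∃ y : G, y • (Quotient.mk _ v : orbitRel.Quotient G V).out = v := fun v =>
    (orbitRel G V).symm (Quotient.mk_out (s := orbitRel G V) v)
  choose x hx using hx
  choose y hy using hy
  refine ⟨fun d => x d * y (src (Quotient.mk _ d : orbitRel.Quotient G D).out), ?_, ?_⟩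
  · intro d
    have : (Quotient.mk _ (src d) : orbitRel.Quotient G V) =
        Quotient.mk _ (src (Quotient.mk _ d : orbitRel.Quotient G D).out) :=
      Quotient.sound ⟨x d, (hsrc _ _).symm.trans (congrArg src (hx d))⟩
    rw [this, mul_smul, hy, ← hsrc, hx]
  · intro g d
    have hq : (Quotient.mk _ (g • d) : orbitRel.Quotient G D) = Quotient.mk _ d :=
      Quotient.sound ⟨g, rfl⟩
    have h1 : ∀ d : D, (x d)⁻¹ • d = (Quotient.mk _ d : orbitRel.Quotient G D).out := fun d => by
      rw [inv_smul_eq_iff, hx]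
    simp only [mul_inv_rev, mul_smul, h1]
    rw [hq]

/-- An invariant cocycle on the pairs of edges with a common origin, with values in a finite
group, that detects the subgroups generated by edge stabilizers. -/
theorem exists_invariant_cocycle (hsrc : ∀ (g : G) d, src (g • d) = g • src d)
    [Finite (orbitRel.Quotient G V)] (hfin : ∀ v, Finite {d // src d = v})
    (hne : ∀ v, ∃ d, src d = v) :
    ∃ (K : Type (max u v)) (_ : Group K) (_ : Finite K) (δ : D → D → K),
      (∀ a b c, src a = src b → src b = src c → δ a c = δ b c * δ a b) ∧
      (∀ (g : G) a b, src a = src b → δ (g • a) (g • b) = δ a b) ∧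
      ∀ (g : G) d, src (g • d) = src d → δ d (g • d) = 1 →
        g ∈ edgeStabilizers G src (src d) := by
  obtain ⟨K, _, _, ρ, hmul, hone⟩ := exists_finite_local_quotient hsrc hfin hne
  obtain ⟨h, hh, hinv⟩ := exists_translation (G := G) hsrc
  have hmem : ∀ a b, src a = src b →
      (h b)⁻¹ * h a ∈ stabilizer G (Quotient.mk _ (src a) : orbitRel.Quotient G V).out := by
    intro a b hab
    rw [mem_stabilizer_iff, mul_smul, hh, inv_smul_eq_iff, hab, hh]
  have hq : ∀ (g : G) d, (Quotient.mk _ (src (g • d)) : orbitRel.Quotient G V) =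
      Quotient.mk _ (src d) := fun g d => Quotient.sound ⟨g, (hsrc g d).symm⟩
  -- The choice of `h` makes g * h d and h (g • d) differ by the stabilizer of a single edge at the
  -- orbit representative, which `ρ` kills; hence the invariance of δ.
  have hk : ∀ (g : G) d, (h d)⁻¹ * g⁻¹ * h (g • d) ∈
      edgeStabilizers G src (Quotient.mk _ (src d) : orbitRel.Quotient G V).out := by
    intro g d
    refine Subgroup.subset_closure ⟨(h d)⁻¹ • d, ?_, ?_⟩
    · rw [hsrc, inv_smul_eq_iff, hh]
    · rw [← hinv g d]
      simp only [mul_smul, smul_inv_smul, inv_smul_smul]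
      exact (hinv g d).symm
  have hle : ∀ v, edgeStabilizers G src v ≤ stabilizer G v := by
    refine fun v => (Subgroup.closure_le _).2 ?_
    rintro g ⟨d, rfl, hg⟩
    exact (hsrc g d).symm.trans (congrArg src hg)
  refine ⟨K, inferInstance, inferInstance,
    fun a b => ρ (Quotient.mk _ (src a)) ((h b)⁻¹ * h a), ?_, ?_, ?_⟩
  · intro a b c hab hbc
    have h1 := hmem b c hbc
    rw [← hab] at h1
    dsimp only
    rw [← hab, ← hmul _ _ _ h1 (hmem a b hab)]
    congr 1
    group
  · intro g a b hab
    dsimp only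
    rw [hq]
    have ha := hk g a
    have hb := hk g b
    rw [← hab] at hb
    have e : (h (g • b))⁻¹ * h (g • a) =
        ((h b)⁻¹ * g⁻¹ * h (g • b))⁻¹ * ((h b)⁻¹ * h a) * ((h a)⁻¹ * g⁻¹ * h (g • a)) := by
      group
    have hb' := inv_mem hb
    rw [e, hmul _ _ _ (mul_mem (hle _ hb') (hmem a b hab)) (hle _ ha),
      hmul _ _ _ (hle _ hb') (hmem a b hab), (hone _ _ (hle _ hb')).2 hb',
      (hone _ _ (hle _ ha)).2 ha, one_mul, mul_one]
  · intro g d hg hδ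
    have h1 := (hone _ _ (hmem d (g • d) hg.symm)).1 hδ
    have h2 := mul_mem (hk g d) h1
    have h3 := conj_mem_edgeStabilizers hsrc h2 (h d)
    rw [hh] at h3
    have e : h d * ((h d)⁻¹ * g⁻¹ * h (g • d) * ((h (g • d))⁻¹ * h d)) * (h d)⁻¹ = g⁻¹ := by
      group
    rw [e] at h3
    exact inv_mem_iff.1 h3

/-- A U-orbit is determined by its G-orbit and a coset of U. -/
theorem finite_orbits_subgroup [Finite (orbitRel.Quotient G V)] (U : Subgroup G)
    [U.FiniteIndex] : Finite (orbitRel.Quotient U V) := by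
  have hy : ∀ v : V, ∃ y : G, y • (Quotient.mk _ v : orbitRel.Quotient G V).out = v := fun v =>
    (orbitRel G V).symm (Quotient.mk_out (s := orbitRel G V) v)
  choose y hy using hy
  refine Finite.of_injective (fun q : orbitRel.Quotient U V =>
    ((Quotient.mk _ q.out : orbitRel.Quotient G V), (((y q.out)⁻¹ : G) : G ⧸ U))) ?_
  intro q q' h
  obtain ⟨h1, h2⟩ := Prod.ext_iff.1 h
  dsimp only at h1 h2
  rw [QuotientGroup.eq, inv_inv] at h2
  rw [← q.out_eq, ← q'.out_eq]
  refine Quotient.sound ⟨⟨_, h2⟩, ?_⟩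
  change (y q.out * (y q'.out)⁻¹) • q'.out = q.out
  have h3 : (y q'.out)⁻¹ • q'.out = (Quotient.mk _ q'.out : orbitRel.Quotient G V).out :=
    inv_smul_eq_iff.2 (hy _).symm
  rw [mul_smul, h3, ← h1, hy]

end Cocycle

/-! ### Labellings and the finite-index subgroup -/

section Labelling

universe u v

variable {V : Type v} {T : SimpleGraph V} {G : Type u} [Group G] [MulAction G T.Dart]

/-- The edge labellings that are prescribed by `δ` around each vertex and that change by `z` when
the orientation is reversed. -/
def labellings {K : Type*} [Group K] (δ : T.Dart → T.Dart → K) (z : K) : Set (T.Dart → K) :=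
  {l | (∀ d, l d.symm = l d * z) ∧ ∀ a b : T.Dart, a.fst = b.fst → l b = δ a b * l a}

variable {K : Type*} [Group K] {δ : T.Dart → T.Dart → K} {z : K}

theorem labellings_nonempty (hT : T.IsTree) (hne : ∀ v, ∃ d : T.Dart, d.fst = v)
    (hδ : ∀ a b c : T.Dart, a.fst = b.fst → b.fst = c.fst → δ a c = δ b c * δ a b)
    (hz : z * z = 1) : (labellings δ z).Nonempty := by
  choose b hb using hne
  -- Here `s v` is the label of the reference edge `b v`. Transport along `d` passes from `b d.fst`
  -- to `d`, reverses it, then passes from `d.symm` to `b d.snd`.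
  obtain ⟨s, hs⟩ := exists_section_of_isTree hT
    (fun d x => (δ (b d.snd) d.symm)⁻¹ * δ (b d.fst) d * x * z) (fun d x => by
      simp only [Dart.symm_symm]
      change (δ (b d.fst) d)⁻¹ * δ (b d.snd) d.symm *
        ((δ (b d.snd) d.symm)⁻¹ * δ (b d.fst) d * x * z) * z = x
      simp [mul_assoc, hz]) (1 : K)
  refine ⟨fun d => δ (b d.fst) d * s d.fst, ?_, ?_⟩
  · intro d
    change δ (b d.snd) d.symm * s d.snd = _
    rw [hs]
    group
  · intro x y hxy
    dsimp only
    rw [← hxy, hδ (b x.fst) x y (hb _) hxy, mul_assoc]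

/-- Agreement at one edge spreads around its origin through δ and across reversals through `z`,
hence to the whole connected tree. -/
theorem labellings_ext (hT : T.IsTree) {l l' : T.Dart → K} (hl : l ∈ labellings δ z)
    (hl' : l' ∈ labellings δ z) {d : T.Dart} (hd : l d = l' d) : l = l' := by
  have key : ∀ a b : T.Dart, a.fst = b.fst → l a = l' a → l b = l' b := fun a b hab h => by
    rw [hl.2 a b hab, hl'.2 a b hab, h]
  have h := eq_of_forall_dart hT.connected (f := fun v => ∀ a : T.Dart, a.fst = v → l a = l' a)
    (fun a => by
      have hs : l a.symm = l' a.symm ↔ l a = l' a := by rw [hl.1, hl'.1, mul_left_inj]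
      refine propext ⟨fun h b hb => ?_, fun h b hb => ?_⟩
      · exact key a b hb.symm (hs.1 (h a.symm rfl))
      · exact key a.symm b hb.symm (hs.2 (h a rfl)))
  funext e
  have := h d.fst e.fst
  exact this.mp (fun a ha => key d a ha.symm hd) e rfl

theorem exists_finiteIndex_subgroup [Finite K] (hT : T.IsTree)
    (hfst : ∀ (g : G) (a b : T.Dart), a.fst = b.fst → (g • a).fst = (g • b).fst)
    (hsymm : ∀ (g : G) (d : T.Dart), (g • d).symm = g • d.symm)
    (hne : ∀ v, ∃ d : T.Dart, d.fst = v)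
    (hδ : ∀ a b c : T.Dart, a.fst = b.fst → b.fst = c.fst → δ a c = δ b c * δ a b)
    (hinv : ∀ (g : G) (a b : T.Dart), a.fst = b.fst → δ (g • a) (g • b) = δ a b)
    (hz : z * z = 1) (hz1 : z ≠ 1) :
    ∃ U : Subgroup G, U.FiniteIndex ∧ (∀ d : T.Dart, stabilizer G d ≤ U) ∧
      (∀ g ∈ U, ∀ d : T.Dart, g • d ≠ d.symm) ∧
      ∀ g ∈ U, ∀ d : T.Dart, (g • d).fst = d.fst → δ d (g • d) = 1 := by
  have hmem : ∀ (g : G) l, l ∈ labellings δ z → (fun d => l (g⁻¹ • d)) ∈ labellings δ z := by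
    refine fun g l hl => ⟨fun d => ?_, fun a b hab => ?_⟩
    · dsimp only
      rw [← hsymm, hl.1]
    · dsimp only
      rw [hl.2 _ _ (hfst g⁻¹ a b hab), hinv g⁻¹ a b hab]
  let _ : MulAction G (labellings δ z) :=
    { smul := fun g l => ⟨fun d => l.1 (g⁻¹ • d), hmem g l.1 l.2⟩
      one_smul := fun l => Subtype.ext (funext fun d => by
        change l.1 ((1 : G)⁻¹ • d) = l.1 d
        simp)
      mul_smul := fun g h l => Subtype.ext (funext fun d => by
        change l.1 ((g * h)⁻¹ • d) = l.1 (h⁻¹ • g⁻¹ • d)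
        rw [mul_inv_rev, mul_smul]) }
  have hsmul : ∀ (g : G) (l : labellings δ z) d, (g • l).1 d = l.1 (g⁻¹ • d) :=
    fun _ _ _ => rfl
  obtain ⟨v₀⟩ := hT.connected.nonempty
  obtain ⟨d₀, -⟩ := hne v₀
  have : Finite (labellings δ z) := Finite.of_injective (fun l => l.1 d₀)
    fun l l' h => Subtype.ext (labellings_ext hT l.2 l'.2 h)
  obtain ⟨l, hl⟩ := labellings_nonempty hT hne hδ hz
  have hU : ∀ g ∈ (toPermHom G (labellings δ z)).ker, ∀ d, l (g • d) = l d := by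
    intro g hg d
    have h1 : g • (⟨l, hl⟩ : labellings δ z) = ⟨l, hl⟩ := DFunLike.congr_fun hg _
    have h2 := congrFun (congrArg Subtype.val h1) (g • d)
    rw [hsmul, inv_smul_smul] at h2
    exact h2.symm
  refine ⟨(toPermHom G (labellings δ z)).ker, inferInstance, ?_, ?_, ?_⟩
  -- If `g` fixes `d`, each labelling and its translate agree at `d`, hence everywhere.
  · intro d g hg
    refine Equiv.ext fun m => Subtype.ext (labellings_ext hT (g • m).2 m.2 (d := d) ?_)
    change m.1 (g⁻¹ • d) = m.1 d
    rw [inv_smul_eq_iff.2 (mem_stabilizer_iff.1 hg).symm]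
  · intro g hg d hd
    have := hU g hg d
    rw [hd, hl.1] at this
    exact hz1 (mul_eq_left.1 this)
  · intro g hg d hd
    have := hU g hg d
    rw [hl.2 d (g • d) hd.symm] at this
    exact mul_eq_right.1 this

end Labelling

/-! ### Closed paths in the quotient graph and maps onto ℤ -/

section Quotient

variable {V : Type*} {T : SimpleGraph V} {U : Type*} [Group U] [MulAction U V]
  [MulAction U T.Dart]

/-- If the quotient graph is finite and has no vertex of valency one, some sequence of edges of the
tree projects to a simple closed path. -/
theorem exists_simple_closed_path [Nonempty V] [Finite (orbitRel.Quotient U V)]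
    (hloc : ∀ d : T.Dart, ∃ e : T.Dart, e.fst = d.fst ∧ ∀ u : U, u • d ≠ e)
    (hne : ∀ v, ∃ d : T.Dart, d.fst = v) :
    ∃ (x : ℕ → T.Dart) (k : ℕ) (g : U), (∀ n, (x (n + 1)).fst = (x n).snd) ∧
      (∀ (n) (u : U), u • (x n).symm ≠ x (n + 1)) ∧ g • (x 0).fst = (x (k + 1)).fst ∧
      (∀ j, j < k → ∀ u : U, u • (x 0).fst ≠ (x (j + 1)).fst) ∧
      ∀ j, j + 1 < k → ∀ u : U, u • (x 1).fst ≠ (x (j + 2)).fst := by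
  classical
  choose nxt hnxt hnxt' using fun d : T.Dart => hloc d.symm
  obtain ⟨v₀⟩ := ‹Nonempty V›
  obtain ⟨d₀, -⟩ := hne v₀
  let y : ℕ → T.Dart := fun n => nxt^[n] d₀
  have hy : ∀ n, y (n + 1) = nxt (y n) := fun n => Function.iterate_succ_apply' nxt n d₀
  have hex : ∃ k : ℕ, ∃ (m : ℕ) (u : U), u • (y m).fst = (y (m + (k + 1))).fst := by
    obtain ⟨m, n, hmn, h⟩ := Finite.exists_ne_map_eq_of_infinite
      (fun n => (Quotient.mk _ (y n).fst : orbitRel.Quotient U V))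
    have key : ∀ m n : ℕ, m < n → (Quotient.mk _ (y m).fst : orbitRel.Quotient U V) =
        Quotient.mk _ (y n).fst →
        ∃ k : ℕ, ∃ (m : ℕ) (u : U), u • (y m).fst = (y (m + (k + 1))).fst := by
      intro m n hmn h
      obtain ⟨u, hu⟩ := Quotient.exact h.symm
      refine ⟨n - m - 1, m, u, ?_⟩
      rw [show m + (n - m - 1 + 1) = n by omega]
      exact hu
    rcases lt_or_gt_of_ne hmn with h' | h'
    exacts [key m n h' h, key n m h' h.symm]
  -- Minimality of the gap over all starting points `m` makes the projected path simple.
  obtain ⟨m, g, hg⟩ := Nat.find_spec hex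
  refine ⟨fun n => y (m + n), Nat.find hex, g, ?_, ?_, hg, ?_, ?_⟩
  · intro n
    change (y (m + n + 1)).fst = _
    rw [hy, hnxt]
    rfl
  · intro n u
    change _ ≠ y (m + n + 1)
    rw [hy]
    exact hnxt' _ u
  · exact fun j hj u hu => Nat.find_min hex hj ⟨m, u, hu⟩
  · intro j hj u hu
    refine Nat.find_min hex (show j < _ by omega) ⟨m + 1, u, ?_⟩
    rw [show m + 1 + (j + 1) = m + (j + 2) by omega]
    exact hu

/-- A group acting on a tree without inversions, such that the quotient graph is finite and has no
vertex of valency one, maps onto `ℤ`. -/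
theorem exists_surjective_int (hT : T.IsTree) [Finite (orbitRel.Quotient U V)]
    (hfst : ∀ (u : U) (d : T.Dart), (u • d).fst = u • d.fst)
    (hsymm : ∀ (u : U) (d : T.Dart), (u • d).symm = u • d.symm)
    (hflip : ∀ (u : U) (d : T.Dart), u • d ≠ d.symm)
    (hloc : ∀ d : T.Dart, ∃ e : T.Dart, e.fst = d.fst ∧ ∀ u : U, u • d ≠ e)
    (hne : ∀ v, ∃ d : T.Dart, d.fst = v) :
    ∃ f : U →* Multiplicative ℤ, Function.Surjective f ∧
      ∀ v : V, stabilizer U v ≤ f.ker := by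
  classical
  have := hT.connected.nonempty
  obtain ⟨x, k, g, hx, hback, hg, h0, h1⟩ := exists_simple_closed_path (U := U) hloc hne
  -- The signed indicator of the orbit of `x 0` descends to the quotient; its primitive `s` on the
  -- tree changes under each `u` by a constant, the value of `f` at `u`.
  let c : T.Dart → ℤ := fun d =>
    (if d ∈ orbit U (x 0) then 1 else 0) - (if d.symm ∈ orbit U (x 0) then 1 else 0)
  have hc : ∀ d, c d.symm = -c d := fun d => by simp [c]
  have hcu : ∀ (u : U) d, c (u • d) = c d := fun u d => by
    have h : ∀ e : T.Dart, u • e ∈ orbit U (x 0) ↔ e ∈ orbit U (x 0) := fun e => by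
      rw [← orbit_eq_iff, orbit_smul, orbit_eq_iff]
    simp only [c, hsymm, h]
  obtain ⟨s, hs⟩ := exists_section_of_isTree hT (fun d n => n + c d)
    (fun d n => by simp [hc]) (0 : ℤ)
  have hsnd : ∀ (u : U) (d : T.Dart), (u • d).snd = u • d.snd := fun u d => by
    have := hfst u d.symm
    rw [← hsymm] at this
    exact this
  have hconst : ∀ (u : U) v w, s (u • v) - s v = s (u • w) - s w := fun u =>
    eq_of_forall_dart hT.connected (f := fun v => s (u • v) - s v) fun d => by
      have := hs (u • d)
      rw [hsnd, hfst, hcu] at this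
      rw [this, hs d]
      ring
  let v := (x 0).fst
  let f : U →* Multiplicative ℤ :=
    { toFun := fun u => Multiplicative.ofAdd (s (u • v) - s v)
      map_one' := by simp
      map_mul' := fun a b => by
        rw [← ofAdd_add, mul_smul, hconst a v (b • v)]
        congr 1
        ring }
  have hf : ∀ u, f u = Multiplicative.ofAdd (s (u • v) - s v) := fun _ => rfl
  have hc0 : c (x 0) = 1 := by
    have : (x 0).symm ∉ orbit U (x 0) := fun ⟨u, hu⟩ => hflip u _ hu
    simp [c, this, mem_orbit_self]
  have hcj : ∀ j, j < k → c (x (j + 1)) = 0 := by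
    intro j hj
    have ha : x (j + 1) ∉ orbit U (x 0) := by
      rintro ⟨u, hu⟩
      refine h0 j hj u ?_
      rw [← hfst]
      exact congrArg (fun d : T.Dart => d.fst) hu
    have hb : (x (j + 1)).symm ∉ orbit U (x 0) := by
      rintro ⟨u, hu⟩
      have hu' : u • (x 0).symm = x (j + 1) := by
        rw [← hsymm, show u • x 0 = _ from hu, Dart.symm_symm]
      -- The next edge is excluded by the absence of backtracking, later ones by simplicity.
      rcases j with _ | j
      · exact hback 0 u hu'
      · refine h1 j hj u ?_
        rw [hx 0]
        change u • (x 0).symm.fst = _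
        rw [← hfst, hu']
    simp [c, ha, hb]
  have hsum : ∀ j, j ≤ k → s (x (j + 1)).fst = s v + 1 := by
    intro j
    induction j with
    | zero => intro _; rw [hx, hs, hc0]
    | succ j ih => intro hj; rw [hx, hs, hcj j hj, ih (by omega), add_zero]
  have hfg : f g = Multiplicative.ofAdd 1 := by
    rw [hf, hg, hsum k le_rfl]
    congr 1
    ring
  refine ⟨f, fun n => ⟨g ^ n.toAdd, ?_⟩, fun w u hu => ?_⟩
  · rw [map_zpow, hfg, ← ofAdd_zsmul]
    simp
  · rw [MonoidHom.mem_ker, hf, hconst u v w, mem_stabilizer_iff.1 hu, sub_self]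
    rfl

end Quotient

/-! ### Translation from automorphisms to actions -/

section Action

variable {V G : Type*} {T : SimpleGraph V} [Group G]

/-- The action on the vertices given by a homomorphism to the automorphism group. -/
abbrev vertexMulAction (φ : G →* (T ≃g T)) : MulAction G V where
  smul g v := φ g v
  one_smul v := by
    change φ 1 v = v
    simp
  mul_smul g h v := by
    change φ (g * h) v = φ g (φ h v)
    simp

/-- The action on the oriented edges given by a homomorphism to the automorphism group. -/
abbrev dartMulAction (φ : G →* (T ≃g T)) : MulAction G T.Dart where
  smul g d := mapEdge (φ g) d
  one_smul d := by
    apply Dart.ext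
    change (φ 1 d.fst, φ 1 d.snd) = (d.fst, d.snd)
    simp
  mul_smul g h d := by
    apply Dart.ext
    change (φ (g * h) d.fst, φ (g * h) d.snd) = (φ g (φ h d.fst), φ g (φ h d.snd))
    simp

theorem finite_orbits_of_vertexOrbit (φ : G →* (T ≃g T))
    (horb : (Set.range (vertexOrbit φ)).Finite) :
    letI := vertexMulAction φ
    Finite (orbitRel.Quotient G V) := by
  let _ := vertexMulAction φ
  have := horb.to_subtype
  refine Finite.of_injective (fun q : orbitRel.Quotient G V =>
    (⟨vertexOrbit φ q.out, q.out, rfl⟩ : Set.range (vertexOrbit φ))) fun q q' h => ?_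
  have h' : vertexOrbit φ q.out = vertexOrbit φ q'.out := congrArg Subtype.val h
  have hq : q.out ∈ vertexOrbit φ q'.out := h' ▸ ⟨1, by simp⟩
  rw [← q.out_eq, ← q'.out_eq]
  exact Quotient.sound hq

theorem exists_edge_ne_of_not_isPretransitive (φ : G →* (T ≃g T)) (d : T.Dart)
    (hloc : ¬ IsPretransitive (pointStabilizerSubgroup (localAction φ d.fst))
      (EdgesAt T d.fst)) :
    letI := dartMulAction φ
    ∃ e : T.Dart, e.fst = d.fst ∧
      ∀ g ∈ edgeStabilizers G (fun d : T.Dart => d.fst) d.fst, g • d ≠ e := by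
  let _ := dartMulAction φ
  by_contra! hcon
  have hle : edgeStabilizers G (fun d : T.Dart => d.fst) d.fst ≤
      ((pointStabilizerSubgroup (localAction φ d.fst)).comap (edgeAction φ d.fst)).map
        (vertexStabilizer φ d.fst).subtype := by
    refine (Subgroup.closure_le _).2 ?_
    rintro g ⟨e, he, hge⟩
    have hg : g ∈ vertexStabilizer φ d.fst := by
      change φ g d.fst = d.fst
      rw [← he]
      exact congrArg (fun d : T.Dart => d.fst) hge
    exact ⟨⟨g, hg⟩, Subgroup.subset_closure ⟨⟨⟨g, hg⟩, rfl⟩, ⟨e, he⟩, Subtype.ext hge⟩, rfl⟩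
  refine hloc ((isPretransitive_iff_base ⟨d, rfl⟩).2 fun e => ?_)
  obtain ⟨g, hg, hge⟩ := hcon e.1 e.2
  obtain ⟨k, hk, rfl⟩ := hle hg
  exact ⟨⟨_, hk⟩, Subtype.ext hge⟩

theorem isOpen_vertexStabilizer [TopologicalSpace G] (φ : G →* (T ≃g T)) (hφ : Continuous φ)
    (v : V) : IsOpen (vertexStabilizer φ v : Set G) := by
  have h : IsOpen {a : T ≃g T | a v = v} := by
    refine IsOpen.mono (t₂ := TopologicalSpace.induced (fun a : T ≃g T => (fun v : V => a v))
      (@Pi.topologicalSpace V (fun _ => V) (fun _ => ⊥))) ?_ inf_le_left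
    let _ : TopologicalSpace V := ⊥
    have : DiscreteTopology V := ⟨rfl⟩
    exact isOpen_induced_iff.2 ⟨(fun f : V → V => f v) ⁻¹' {v},
      (isOpen_discrete {v}).preimage (continuous_apply v), rfl⟩
  exact h.preimage hφ

end Action

end TreeAction

/-! ### The main theorem -/

open TreeAction MulAction in
theorem mainTheorem1 {V G : Type*} [Infinite V] (T : SimpleGraph V) (hT : T.IsTree)
    (hfin : ∀ v, Finite (TreeAction.EdgesAt T v))
    (hleaf : ∀ v, Nat.card (TreeAction.EdgesAt T v) ≠ 1)
    [Group G] [TopologicalSpace G] [IsTopologicalGroup G]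
    (φ : G →* (T ≃g T)) (hφ : Continuous φ)
    (horb : (Set.range (TreeAction.vertexOrbit φ)).Finite)
    (hloc : ∀ v, ¬ MulAction.IsPretransitive
      (TreeAction.pointStabilizerSubgroup (TreeAction.localAction φ v))
      (TreeAction.EdgesAt T v)) :
    TreeAction.VirtuallyIndicable G := by
  let _ := vertexMulAction φ
  let _ := dartMulAction φ
  have := finite_orbits_of_vertexOrbit φ horb
  have hfst : ∀ (g : G) (d : T.Dart), (g • d).fst = g • d.fst := fun _ _ => rfl
  have hsymm : ∀ (g : G) (d : T.Dart), (g • d).symm = g • d.symm := fun _ _ => rfl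
  have hne : ∀ v, ∃ d : T.Dart, d.fst = v := fun v => by
    -- An action on an empty E(v) would be vacuously transitive.
    by_contra! h
    exact hloc v ⟨fun e => (h e.1 e.2).elim⟩
  obtain ⟨K, _, _, δ, hδ, hinv, hmem⟩ :=
    exists_invariant_cocycle (G := G) (src := fun d : T.Dart => d.fst) hfst hfin hne
  obtain ⟨U, hU, hstab, hflip, htriv⟩ := exists_finiteIndex_subgroup (G := G)
    (K := K × Multiplicative (ZMod 2)) (δ := fun a b => (δ a b, 1))
    (z := (1, Multiplicative.ofAdd 1)) hT
    (fun g a b hab => by rw [hfst, hfst, hab]) hsymm hne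
    (fun a b c hab hbc => by simp [← hδ a b c hab hbc])
    (fun g a b hab => by simp [hinv g a b hab])
    (Prod.ext (one_mul 1) (show Multiplicative.ofAdd (1 : ZMod 2) * .ofAdd 1 = 1 by decide))
    (fun h => absurd (congrArg Prod.snd h)
      (show Multiplicative.ofAdd (1 : ZMod 2) ≠ 1 by decide))
  have := finite_orbits_subgroup (V := V) U
  have hopen : IsOpen (U : Set G) := by
    obtain ⟨v⟩ := hT.connected.nonempty
    obtain ⟨d, -⟩ := hne v
    refine Subgroup.isOpen_mono
      (H₁ := vertexStabilizer φ d.fst ⊓ vertexStabilizer φ d.snd) (le_trans ?_ (hstab d))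
      ((isOpen_vertexStabilizer φ hφ d.fst).inter (isOpen_vertexStabilizer φ hφ d.snd))
    exact fun g hg => SimpleGraph.Dart.ext _ _ (Prod.ext hg.1 hg.2)
  obtain ⟨f, hf, hker⟩ := exists_surjective_int (U := U) hT (fun u d => hfst u d)
    (fun u d => hsymm u d) (fun u d => hflip u u.2 d) (fun d => by
      obtain ⟨e, he, hed⟩ := exists_edge_ne_of_not_isPretransitive φ d (hloc d.fst)
      refine ⟨e, he, fun u hu => ?_⟩
      change (u : G) • d = e at hu
      have hud : ((u : G) • d).fst = d.fst := by rw [hu, he]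
      exact hed u (hmem u d hud (congrArg Prod.fst (htriv u u.2 d hud))) hu) hne
  refine ⟨U, hopen, hU, f, ?_, hf⟩
  obtain ⟨v⟩ := hT.connected.nonempty
  have hkopen : IsOpen (f.ker : Set U) := by
    refine Subgroup.isOpen_mono (H₁ := (vertexStabilizer φ v).subgroupOf U)
      (fun u hu => hker v hu) ?_
    exact (isOpen_vertexStabilizer φ hφ v).preimage continuous_subtype_val
  -- The kernel is open because it contains an open vertex stabilizer.
  refine continuous_of_continuousAt_one f ?_
  rw [ContinuousAt, map_one, nhds_discrete (Multiplicative ℤ), Filter.tendsto_pure]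
  exact hkopen.mem_nhds (one_mem f.ker)
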